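/- Let $F_2^n$ be the set of binary vectors of length $n$. For $x,y\in F_2^n$ put $\langle x,y\rangle = 1-2d(x,y)/n$, where $d$ is the Hamming distance, and let $Q_i^{(n)}$ ($0\le i\le n$) be the normalized Krawtchouk polynomials: $Q_0^{(n)}(t)=1$, $Q_1^{(n)}(t)=t$, $ntQ_i^{(n)}(t)=(n-i)Q_{i+1}^{(n)}(t)+iQ_{i-1}^{(n)}(t)$ for $1\le i\le n-1$. For $1\le k\le n/2$, a non-empty set $C\subseteq F_2^n$ is a $(k,k)$-design if $\sum_{x,y\in C}Q_i^{(n)}(\langle x,y\rangle)=0$ for all $i\in\{2,4,\dots,2k\}$, and it is tight if moreover $|C|=\sum_{i=0}^{k}\binom{n-1}{i}$. Theorem. (i) If a tight $(3,3)$-design $C\subseteq F_2^n$ exists, then $n=(m^2+8)/3$ for some integer $m\ge 4$, and either $n\equiv 8\pmod{16}$ with $m$ divisible by $4$ and not divisible by $3$, or $n\equiv 107\pmod{128}$ with $m\equiv 43\pmod{64}$. (ii) The extended binary Golay code is a linear $[24,12,8]$ code. Every binary linear $[24,12,8]$ code $D$ contains, with each $x$, the antipodal point $\bar x$ (the point at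 distance $24$ from $x$); sets containing exactly one point of each antipodal pair $\{x,\bar x\}\subseteq D$ exist, and each such set is a tight $(3,3)$-design in $F_2^{24}$ with $2048$ points. -/

import Mathlib

/-- The "inner product" `⟨x, y⟩ = 1 - 2 d(x, y) / n` of two binary vectors of length `n`,
where `d` is the Hamming distance. -/
noncomputable def hammingInner {n : ℕ} (x y : Fin n → ZMod 2) : ℝ :=
  1 - 2 * (hammingDist x y : ℝ) / (n : ℝ)

/-- The normalized binary Krawtchouk polynomials `Q_i^{(n)}(t)`, evaluated at `t`:
`Q_0 = 1`, `Q_1 = t` and `n t Q_i = (n - i) Q_{i+1} + i Q_{i-1}` for `1 ≤ i ≤ n - 1`.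
Only the values with `i ≤ n` are meaningful, and for these no division by zero occurs. -/
noncomputable def krawtchoukQ (n : ℕ) : ℕ → ℝ → ℝ
  | 0, _ => 1
  | 1, t => t
  | i + 2, t =>
      ((n : ℝ) * t * krawtchoukQ n (i + 1) t - ((i : ℝ) + 1) * krawtchoukQ n i t) /
        ((n : ℝ) - ((i : ℝ) + 1))

/-- The `i`-th moment `M_i(C) = ∑_{x, y ∈ C} Q_i^{(n)}(⟨x, y⟩)` of a binary code `C`. -/
noncomputable def codeMoment {n : ℕ} (C : Finset (Fin n → ZMod 2)) (i : ℕ) : ℝ :=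
  ∑ x ∈ C, ∑ y ∈ C, krawtchoukQ n i (hammingInner x y)

/-- A non-empty code `C` is a `T`-design, `T ⊆ {1, …, n}`, if `M_i(C) = 0` for all `i ∈ T`. -/
def IsTDesign {n : ℕ} (T : Set ℕ) (C : Finset (Fin n → ZMod 2)) : Prop :=
  C.Nonempty ∧ T ⊆ Set.Icc 1 n ∧ ∀ i ∈ T, codeMoment C i = 0

/-- A `(k, k)`-design: a `T`-design with `T = {2, 4, …, 2k}`, where `1 ≤ k ≤ n / 2`. -/
def IsKKDesign {n : ℕ} (k : ℕ) (C : Finset (Fin n → ZMod 2)) : Prop :=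
  1 ≤ k ∧ 2 * k ≤ n ∧ IsTDesign {i | ∃ j ∈ Set.Icc 1 k, i = 2 * j} C

/-- A tight `(k, k)`-design: one of cardinality `∑_{i=0}^{k} (n-1 choose i)`. -/
def IsTightKKDesign {n : ℕ} (k : ℕ) (C : Finset (Fin n → ZMod 2)) : Prop :=
  IsKKDesign k C ∧ C.card = ∑ i ∈ Finset.range (k + 1), (n - 1).choose i

/-- `D` is a binary linear code with parameters `[n, k, d]`: length `n`, dimension `k`,
minimum distance (between distinct codewords) exactly `d`. -/
def IsBinaryLinearCode (n k d : ℕ) (D : Submodule (ZMod 2) (Fin n → ZMod 2)) : Prop :=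
  Module.finrank (ZMod 2) D = k ∧
    IsLeast {e : ℕ | ∃ x ∈ D, ∃ y ∈ D, x ≠ y ∧ e = hammingDist x y} d

/-- The antipode of `x`: the unique point at Hamming distance `n` from `x`. -/
def antipode {n : ℕ} (x : Fin n → ZMod 2) : Fin n → ZMod 2 := fun i => x i + 1

/-- A code is antipodal if it contains the antipode of each of its points. -/
def IsAntipodalCode {n : ℕ} (D : Set (Fin n → ZMod 2)) : Prop :=
  ∀ x ∈ D, antipode x ∈ D

/-- `C` consists of exactly one point from each pair of antipodal points of `D`. -/
def IsAntipodalHalf {n : ℕ} (D : Set (Fin n → ZMod 2)) (C : Finset (Fin n → ZMod 2)) : Prop :=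
  (∀ x ∈ C, x ∈ D) ∧ ∀ x ∈ D, Xor (x ∈ C) (antipode x ∈ C)

/-- The `j`-th row of the standard generator matrix of the extended binary Golay code: the
coefficient vector of `X ^ j * g`, where `g = 1 + X^2 + X^4 + X^5 + X^6 + X^10 + X^11` generates
the cyclic `[23, 12, 7]` Golay code, followed by an overall parity bit (which is `1`). -/
def golayRow (j : Fin 12) : Fin 24 → ZMod 2 := fun i =>
  if i.val = 23 ∨ ∃ e ∈ ({0, 2, 4, 5, 6, 10, 11} : Finset ℕ), i.val = j.val + e then 1 else 0

/-- The extended binary Golay code, a subspace of `F_2^24`. -/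
def extendedGolayCode : Submodule (ZMod 2) (Fin 24 → ZMod 2) :=
  Submodule.span (ZMod 2) (Set.range golayRow)

/-! Both halves are linear programming in the variable u = n - 2d(x, y), where equality forces the
structure. The kernel `zonal k`, the elementary symmetric polynomial in the signs of x + y, is a
polynomial in u proportional to `krawtchoukQ`. Its double sum over a code is a sum of squared
character sums, so a moment is nonnegative, and if it vanishes then so does the row sum at every x.

For a tight (3,3)-design, the even polynomial (`zonal 1` + `zonal 3`)² has constant term |C| and
diagonal value |C|². Hence it vanishes off the diagonal, so u = 0 or u² = 3n - 8. Counting the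
nonzero u with the second moment makes m² = 3n - 8 a divisor of 640, which leaves only n = 8 and n =
24 (`length_of_tight`). Both lie in the class 8 mod 16, so the alternative 107 mod 128 never occurs.

For a [24,12,8] code, a degree 6 polynomial is tight in the same way: moments 1 to 6 vanish and u
takes only four off-diagonal values (`extremal_code_moments`). Moments 1 and 3 give antipodality,
and the even moments pass to an antipodal half. -/

open Finset

/-! ### Characters, zonal kernels and Krawtchouk polynomials -/

/-- The sign `(-1)^a` of `a : ZMod 2`, as a real number. -/
noncomputable def bitSign (a : ZMod 2) : ℝ := if a = 0 then 1 else -1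

/-- The character `x ↦ (-1)^{∑_{j ∈ S} x_j}` of `F_2^n`. -/
noncomputable def signChar {n : ℕ} (S : Finset (Fin n)) (x : Fin n → ZMod 2) : ℝ :=
  ∏ j ∈ S, bitSign (x j)

/-- The kernel `∑_{|S| = k} χ_S(x) χ_S(y)`, a multiple of the zonal function `Q_k(⟨x, y⟩)`. -/
noncomputable def zonal {n : ℕ} (k : ℕ) (x y : Fin n → ZMod 2) : ℝ :=
  ∑ S ∈ powersetCard k univ, signChar S x * signChar S y

theorem bitSign_mul_self (a : ZMod 2) : bitSign a * bitSign a = 1 := by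
  unfold bitSign; split_ifs <;> norm_num

theorem bitSign_add_one (a : ZMod 2) : bitSign (a + 1) = - bitSign a := by
  have h : a + 1 = 0 ↔ ¬ a = 0 := by revert a; decide
  simp only [bitSign, h]
  split_ifs <;> norm_num

theorem bitSign_mul (a b : ZMod 2) : bitSign a * bitSign b = if a ≠ b then -1 else 1 := by
  have h : a ≠ b ↔ ¬ (a = 0 ↔ b = 0) := by revert a b; decide
  simp only [bitSign, h]
  split_ifs <;> simp_all

theorem sum_powersetCard_insert_prod {ι : Type*} [DecidableEq ι] (ε : ι → ℝ) {a : ι}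
    {s : Finset ι} (ha : a ∉ s) (k : ℕ) :
    ∑ T ∈ powersetCard (k + 1) (insert a s), ∏ j ∈ T, ε j =
      ∑ T ∈ powersetCard (k + 1) s, ∏ j ∈ T, ε j +
        ε a * ∑ T ∈ powersetCard k s, ∏ j ∈ T, ε j := by
  have hmem : ∀ T ∈ powersetCard k s, a ∉ T := fun T hT h =>
    ha ((mem_powersetCard.1 hT).1 h)
  rw [powersetCard_succ_insert ha, sum_union, sum_image, mul_sum]
  · congr 1
    exact sum_congr rfl fun T hT => prod_insert (hmem T hT)
  · intro T hT U hU h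
    rw [← erase_insert (hmem T hT), ← erase_insert (hmem U hU), h]
  · rw [disjoint_left]
    intro T hT hT'
    obtain ⟨U, -, rfl⟩ := mem_image.1 hT'
    exact ha ((mem_powersetCard.1 hT).1 (mem_insert_self a U))

/-- The three-term recurrence of the elementary symmetric functions of signs. -/
theorem sum_mul_sum_powersetCard_prod {ι : Type*} [DecidableEq ι] (ε : ι → ℝ)
    (hε : ∀ i, ε i * ε i = 1) (s : Finset ι) (k : ℕ) :
    (∑ j ∈ s, ε j) * ∑ T ∈ powersetCard (k + 1) s, ∏ j ∈ T, ε j =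
      (k + 2) * ∑ T ∈ powersetCard (k + 2) s, ∏ j ∈ T, ε j +
        ((#s : ℝ) - k) * ∑ T ∈ powersetCard k s, ∏ j ∈ T, ε j := by
  induction s using Finset.induction_on generalizing k with
  | empty =>
    have h : ∀ j, powersetCard (j + 1) (∅ : Finset ι) = ∅ := fun j =>
      powersetCard_eq_empty.2 (by simp)
    cases k <;> simp [h]
  | insert a s ha ih =>
    rw [sum_powersetCard_insert_prod ε ha, sum_powersetCard_insert_prod ε ha, sum_insert ha,
      card_insert_of_notMem ha]
    have h1 := ih k
    push_cast
    cases k with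
    | zero =>
      have e1 : ∑ T ∈ powersetCard 1 s, ∏ j ∈ T, ε j = ∑ j ∈ s, ε j := by
        simp [powersetCard_one]
      simp only [powersetCard_zero, sum_singleton, prod_empty, zero_add, e1] at h1 ⊢
      push_cast at h1 ⊢
      linear_combination h1 + hε a
    | succ k =>
      rw [sum_powersetCard_insert_prod ε ha]
      have h0 := ih k
      push_cast at h1 ⊢
      linear_combination h1 + ε a * h0 +
        (∑ T ∈ powersetCard (k + 1) s, ∏ j ∈ T, ε j) * hε a

section zonal
variable {n : ℕ}

theorem zonal_eq (k : ℕ) (x y : Fin n → ZMod 2) :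
    zonal k x y = ∑ S ∈ powersetCard k univ, ∏ j ∈ S, (bitSign (x j) * bitSign (y j)) := by
  simp [zonal, signChar, prod_mul_distrib]

theorem sum_bitSign_mul (x y : Fin n → ZMod 2) :
    ∑ j, bitSign (x j) * bitSign (y j) = n - 2 * (hammingDist x y : ℝ) := by
  have h : ∀ j, bitSign (x j) * bitSign (y j) = 1 - 2 * (if x j ≠ y j then (1 : ℝ) else 0) := by
    intro j; rw [bitSign_mul]; split_ifs <;> norm_num
  simp only [h, sum_sub_distrib, ← mul_sum, sum_boole]
  simp [hammingDist]

theorem zonal_zero (x y : Fin n → ZMod 2) : zonal 0 x y = 1 := by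
  simp [zonal, signChar]

theorem zonal_one (x y : Fin n → ZMod 2) : zonal 1 x y = n - 2 * (hammingDist x y : ℝ) := by
  rw [← sum_bitSign_mul, zonal_eq]; simp [powersetCard_one]

theorem zonal_recurrence (k : ℕ) (x y : Fin n → ZMod 2) :
    zonal 1 x y * zonal (k + 1) x y =
      (k + 2) * zonal (k + 2) x y + ((n : ℝ) - k) * zonal k x y := by
  have := sum_mul_sum_powersetCard_prod (fun j => bitSign (x j) * bitSign (y j))
    (fun j => by rw [mul_mul_mul_comm, bitSign_mul_self, bitSign_mul_self, one_mul]) univ k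
  rw [sum_bitSign_mul, ← zonal_one] at this
  simpa [zonal_eq] using this

/-- Both sides satisfy the same three-term recurrence once the binomial ratios are cleared. -/
theorem choose_mul_krawtchoukQ (hn : n ≠ 0) (x y : Fin n → ZMod 2) :
    ∀ k ≤ n, (n.choose k : ℝ) * krawtchoukQ n k (hammingInner x y) = zonal k x y
  | 0, _ => by simp [krawtchoukQ, zonal_zero]
  | 1, _ => by
    have : (n : ℝ) ≠ 0 := by exact_mod_cast hn
    simp only [krawtchoukQ, Nat.choose_one_right, hammingInner, zonal_one]
    field_simp
  | k + 2, hk => by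
    have h0 := choose_mul_krawtchoukQ hn x y k (by omega)
    have h1 := choose_mul_krawtchoukQ hn x y (k + 1) (by omega)
    have hn' : (n : ℝ) ≠ 0 := by exact_mod_cast hn
    have ht : (n : ℝ) * hammingInner x y = zonal 1 x y := by
      rw [hammingInner, zonal_one]; field_simp
    have hr := zonal_recurrence k x y
    have c1 : (n.choose (k + 1) : ℝ) * (k + 1) = n.choose k * (n - k) := by
      have := Nat.choose_succ_right_eq n k
      rw [← Nat.cast_sub (by omega)]; exact_mod_cast this
    have c2 : (n.choose (k + 2) : ℝ) * (k + 2) = n.choose (k + 1) * (n - (k + 1)) := by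
      have := Nat.choose_succ_right_eq n (k + 1)
      rw [← Nat.cast_add_one, ← Nat.cast_sub (by omega)]; exact_mod_cast this
    have hpos : (n : ℝ) - (k + 1) ≠ 0 := by
      have : (k : ℝ) + 2 ≤ n := by exact_mod_cast hk
      linarith
    have hk2 : (k : ℝ) + 2 ≠ 0 := by positivity
    have hQ : krawtchoukQ n (k + 2) (hammingInner x y) * (n - (k + 1)) =
        zonal 1 x y * krawtchoukQ n (k + 1) (hammingInner x y) -
          (k + 1) * krawtchoukQ n k (hammingInner x y) := by
      rw [krawtchoukQ, ht, div_mul_cancel₀ _ hpos]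
    apply mul_left_cancel₀ hk2
    linear_combination krawtchoukQ n (k + 2) (hammingInner x y) * c2 +
      n.choose (k + 1) * hQ + zonal 1 x y * h1 + hr
      - krawtchoukQ n k (hammingInner x y) * c1 - (n - k) * h0

theorem sum_sum_zonal (C : Finset (Fin n → ZMod 2)) (k : ℕ) :
    ∑ x ∈ C, ∑ y ∈ C, zonal k x y =
      ∑ S ∈ powersetCard k univ, (∑ x ∈ C, signChar S x) ^ 2 := by
  simp only [zonal, sq, sum_mul_sum]
  calc _ = ∑ x ∈ C, ∑ S ∈ powersetCard k univ, ∑ y ∈ C, signChar S x * signChar S y :=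
        sum_congr rfl fun _ _ => sum_comm
    _ = _ := sum_comm

theorem sum_sum_zonal_nonneg (C : Finset (Fin n → ZMod 2)) (k : ℕ) :
    0 ≤ ∑ x ∈ C, ∑ y ∈ C, zonal k x y := by
  rw [sum_sum_zonal]; positivity

/-- A vanishing sum of squares kills each character sum of degree k, so the point x need not lie in
C. -/
theorem sum_zonal_eq_zero {C : Finset (Fin n → ZMod 2)} {k : ℕ}
    (h : ∑ x ∈ C, ∑ y ∈ C, zonal k x y = 0) (x : Fin n → ZMod 2) :
    ∑ y ∈ C, zonal k x y = 0 := by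
  rw [sum_sum_zonal, sum_eq_zero_iff_of_nonneg fun _ _ => sq_nonneg _] at h
  simp only [zonal]
  rw [sum_comm]
  refine sum_eq_zero fun S hS => ?_
  rw [← mul_sum, pow_eq_zero_iff (two_ne_zero) |>.1 (h S hS), mul_zero]

theorem codeMoment_eq_zero_iff {k : ℕ} (hn : n ≠ 0) (hk : k ≤ n)
    (C : Finset (Fin n → ZMod 2)) :
    codeMoment C k = 0 ↔ ∑ x ∈ C, ∑ y ∈ C, zonal k x y = 0 := by
  have hc : (n.choose k : ℝ) ≠ 0 := by exact_mod_cast (Nat.choose_pos hk).ne'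
  have h : (n.choose k : ℝ) * codeMoment C k = ∑ x ∈ C, ∑ y ∈ C, zonal k x y := by
    simp only [codeMoment, mul_sum, choose_mul_krawtchoukQ hn _ _ k hk]
  rw [← h, mul_eq_zero, or_iff_right hc]

theorem zonal_two (x y : Fin n → ZMod 2) :
    zonal 2 x y = (zonal 1 x y ^ 2 - n) / 2 := by
  have h := zonal_recurrence 0 x y
  rw [zonal_zero] at h; norm_num at h
  linear_combination - h / 2

theorem zonal_three (x y : Fin n → ZMod 2) :
    zonal 3 x y = (zonal 1 x y * zonal 2 x y - (n - 1) * zonal 1 x y) / 3 := by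
  have h := zonal_recurrence 1 x y
  norm_num at h
  linear_combination - h / 3

theorem zonal_four (x y : Fin n → ZMod 2) :
    zonal 4 x y = (zonal 1 x y * zonal 3 x y - (n - 2) * zonal 2 x y) / 4 := by
  have h := zonal_recurrence 2 x y
  norm_num at h
  linear_combination - h / 4

theorem zonal_five (x y : Fin n → ZMod 2) :
    zonal 5 x y = (zonal 1 x y * zonal 4 x y - (n - 3) * zonal 3 x y) / 5 := by
  have h := zonal_recurrence 3 x y
  norm_num at h
  linear_combination - h / 5

theorem zonal_six (x y : Fin n → ZMod 2) :
    zonal 6 x y = (zonal 1 x y * zonal 5 x y - (n - 4) * zonal 4 x y) / 6 := by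
  have h := zonal_recurrence 4 x y
  norm_num at h
  linear_combination - h / 6

theorem zonal_one_self (x : Fin n → ZMod 2) : zonal 1 x x = n := by
  simp [zonal_one]

end zonal
-- Minimum weight of the extended Golay code
/-- The word of length `24` whose `i`-th entry is the `i`-th binary digit of `w`. -/
def bitWord (w : ℕ) : Fin 24 → ZMod 2 := fun i => if w.testBit i then 1 else 0

theorem bitWord_xor (a b : ℕ) : bitWord (a ^^^ b) = bitWord a + bitWord b := by
  funext i
  simp only [bitWord, Pi.add_apply, Nat.testBit_xor]
  cases a.testBit i <;> cases b.testBit i <;> decide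

theorem bitWord_zero : bitWord 0 = 0 := by
  funext i; simp [bitWord]

/-- The number whose binary digits are the entries of `golayRow j`. -/
def golayRowNat (j : Fin 12) : ℕ := 3189 <<< j.val ^^^ 8388608

theorem golayRow_eq (j : Fin 12) : golayRow j = bitWord (golayRowNat j) := by
  have h : ∀ j i, golayRow j i = bitWord (golayRowNat j) i := by decide +kernel
  exact funext (h j)

/-- The number of ones among the lowest `24` binary digits. -/
def popcount24 (w : ℕ) : ℕ := (List.range 24).countP fun i => w.testBit i

theorem hammingNorm_bitWord (w : ℕ) : hammingNorm (bitWord w) = popcount24 w := by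
  have : hammingNorm (bitWord w) = #{i : Fin 24 | w.testBit i = true} := by
    simp [hammingNorm, bitWord]
  rw [this, popcount24, Finset.card_filter, Fin.sum_univ_eq_sum_range
    (fun i => if w.testBit i = true then 1 else 0) 24, ← Finset.card_filter]
  simp only [Finset.card, Finset.filter, Finset.range, Multiset.range, Multiset.filter_coe,
    Multiset.coe_card, List.countP_eq_length_filter]
  simp

/-- The binary digits of the sum of the rows `golayRow j` for the `j` with `c j = true`. -/
def golaySumNat (l : List (Fin 12)) (c : Fin 12 → Bool) : ℕ :=
  (l.map fun j => bif c j then golayRowNat j else 0).foldr (· ^^^ ·) 0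

theorem bitWord_golaySumNat (l : List (Fin 12)) (c : Fin 12 → ZMod 2) :
    bitWord (golaySumNat l fun j => decide (c j = 1)) =
      (l.map fun j => c j • golayRow j).sum := by
  induction l with
  | nil => simp [golaySumNat, bitWord_zero]
  | cons j l ih =>
    have : golaySumNat (j :: l) (fun j => decide (c j = 1)) =
        (bif decide (c j = 1) then golayRowNat j else 0) ^^^
          golaySumNat l fun j => decide (c j = 1) := rfl
    rw [this, bitWord_xor, ih, List.map_cons, List.sum_cons, golayRow_eq]
    congr 1
    have h : c j = 0 ∨ c j = 1 := by generalize c j = a; revert a; decide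
    rcases h with h | h <;> simp [h, bitWord_zero]

/-- Whether all sums of `acc` and a set of the given rows have weight at least `8`, apart from
the sum over the empty set if `skip` holds. -/
def minWeightCheck : List ℕ → ℕ → Bool → Bool
  | [], acc, skip => skip || Nat.ble 8 (popcount24 acc)
  | r :: rs, acc, skip => minWeightCheck rs acc skip && minWeightCheck rs (r ^^^ acc) false

theorem minWeightCheck_sound {l : List (Fin 12)} {c : Fin 12 → Bool} {acc : ℕ} {skip : Bool}
    (h : minWeightCheck (l.map golayRowNat) acc skip = true)
    (hc : skip = true → ∃ j ∈ l, c j = true) :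
    8 ≤ popcount24 (golaySumNat l c ^^^ acc) := by
  induction l generalizing acc skip with
  | nil =>
    cases skip
    · simpa [minWeightCheck, golaySumNat] using h
    · simp at hc
  | cons j l ih =>
    simp only [List.map_cons, minWeightCheck, Bool.and_eq_true] at h
    have hs : golaySumNat (j :: l) c =
        (bif c j then golayRowNat j else 0) ^^^ golaySumNat l c := rfl
    cases hj : c j
    · rw [hs, hj, cond_false, Nat.zero_xor]
      refine ih h.1 fun hk => ?_
      obtain ⟨i, hi, hci⟩ := hc hk
      rcases List.mem_cons.1 hi with rfl | hi
      · simp [hj] at hci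
      · exact ⟨i, hi, hci⟩
    · rw [hs, hj, cond_true, Nat.xor_comm (golayRowNat j), Nat.xor_assoc]
      exact ih h.2 (by simp)

/-- The kernel evaluates all 2^12 sums as natural numbers. The bound yields both the dimension and
the minimum distance. -/
theorem eight_le_hammingNorm_sum_golayRow {c : Fin 12 → ZMod 2} (hc : c ≠ 0) :
    8 ≤ hammingNorm (∑ j, c j • golayRow j) := by
  have hs : ∑ j, c j • golayRow j = ((List.finRange 12).map fun j => c j • golayRow j).sum :=
    (Fin.sum_univ_def _)
  rw [hs, ← bitWord_golaySumNat, hammingNorm_bitWord, ← Nat.xor_zero (golaySumNat _ _)]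
  have hcheck : minWeightCheck ((List.finRange 12).map golayRowNat) 0 true = true := by
    decide +kernel
  refine minWeightCheck_sound hcheck fun _ => ?_
  obtain ⟨j, hj⟩ := Function.ne_iff.1 hc
  have h1 : ∀ a : ZMod 2, a ≠ 0 → a = 1 := by decide
  exact ⟨j, List.mem_finRange j, by simpa using h1 _ hj⟩

theorem linearIndependent_golayRow : LinearIndependent (ZMod 2) golayRow := by
  rw [Fintype.linearIndependent_iff]
  intro c hc
  by_contra! h
  have := eight_le_hammingNorm_sum_golayRow (c := c) (fun h0 => by simp [h0] at h)
  simp [hc] at this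

theorem isBinaryLinearCode_extendedGolayCode : IsBinaryLinearCode 24 12 8 extendedGolayCode := by
  refine ⟨?_, ⟨golayRow 0, Submodule.subset_span ⟨0, rfl⟩, 0, zero_mem _, ?_, ?_⟩, ?_⟩
  · exact (finrank_span_eq_card linearIndependent_golayRow).trans (by simp)
  · exact linearIndependent_golayRow.ne_zero 0
  · rw [hammingDist_zero_right]
    decide +kernel
  · rintro _ ⟨x, hx, y, hy, hxy, rfl⟩
    obtain ⟨c, hc⟩ := (Submodule.mem_span_range_iff_exists_fun (ZMod 2)).1
      (show x - y ∈ Submodule.span _ _ from sub_mem hx hy)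
    rw [hammingDist_comm, hammingDist_eq_hammingNorm, neg_add_eq_sub, ← hc]
    refine eight_le_hammingNorm_sum_golayRow fun h => hxy (sub_eq_zero.1 ?_)
    rw [← hc, h]; simp

/-! ### Lengths admitting a tight (3,3)-design -/

section necessary
variable {n : ℕ}

theorem IsKKDesign.sum_zonal_eq_zero {k : ℕ} {C : Finset (Fin n → ZMod 2)}
    (h : IsKKDesign k C) {j : ℕ} (hj : 1 ≤ j) (hjk : j ≤ k) (x : Fin n → ZMod 2) :
    ∑ y ∈ C, zonal (2 * j) x y = 0 := by
  obtain ⟨hk, hkn, -, -, hM⟩ := h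
  exact _root_.sum_zonal_eq_zero ((codeMoment_eq_zero_iff (by omega) (by omega) C).1
    (hM (2 * j) ⟨j, ⟨hj, hjk⟩, rfl⟩)) x

/-- By Pascal's rule the tight size is n + C(n,3), the diagonal value of `zonal 1` + `zonal 3`. -/
theorem card_tight_three (hn : 6 ≤ n) :
    6 * ((∑ i ∈ range 4, (n - 1).choose i : ℕ) : ℝ) = n ^ 3 - 3 * n ^ 2 + 8 * n := by
  obtain ⟨m, rfl⟩ : ∃ m, n = m + 3 := ⟨n - 3, by omega⟩
  have h2 : ((m + 2).choose 2 : ℝ) = (m + 2) * (m + 1) / 2 := by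
    rw [Nat.cast_choose_two]; push_cast; ring
  have h3 : ((m + 2).choose 3 : ℝ) = (m + 2) * (m + 1) * m / 6 := by
    have := Nat.choose_succ_right_eq (m + 2) 2
    have h : ((m + 2).choose 3 : ℝ) * 3 = (m + 2).choose 2 * m := by
      rw [show m + 2 - 2 = m by omega] at this; exact_mod_cast this
    rw [h2] at h; linarith
  simp only [sum_range_succ, sum_range_zero, show m + 3 - 1 = m + 2 by omega,
    Nat.choose_zero_right, Nat.choose_one_right]
  push_cast
  rw [h2, h3]; ring

/-- Distinct points of a tight `(3, 3)`-design have inner product zero or `±√(3n - 8) / n`. -/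
theorem zonal_one_of_tight {C : Finset (Fin n → ZMod 2)} (h : IsTightKKDesign 3 C)
    {x y : Fin n → ZMod 2} (hx : x ∈ C) (hy : y ∈ C) (hxy : y ≠ x) :
    zonal 1 x y = 0 ∨ zonal 1 x y ^ 2 = 3 * n - 8 := by
  have hn : 6 ≤ n := h.1.2.1
  have hcard := card_tight_three hn
  rw [← h.2] at hcard
  have h2 := IsKKDesign.sum_zonal_eq_zero h.1 (j := 1) le_rfl (by omega) x
  have h4 := IsKKDesign.sum_zonal_eq_zero h.1 (j := 2) (by omega) (by omega) x
  have h6 := IsKKDesign.sum_zonal_eq_zero h.1 (j := 3) (by omega) (by omega) x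
  -- Only even kernels occur, and the design conditions remove all but the constant term, which is
  -- |C|.
  have hexp : ∀ z, (zonal 1 x z + zonal 3 x z) ^ 2 =
      20 * zonal 6 x z + (6 * (n - 4) + 8) * zonal 4 x z +
        ((n - 2) * (n - 3) + 2 * (n - 2) + 2) * zonal 2 x z +
        (n ^ 3 - 3 * n ^ 2 + 8 * n) / 6 := by
    intro z
    rw [zonal_six, zonal_five, zonal_four, zonal_three, zonal_two]; ring
  have hsum : ∑ z ∈ C, (zonal 1 x z + zonal 3 x z) ^ 2 = (#C : ℝ) ^ 2 := by
    simp only [hexp, sum_add_distrib, ← mul_sum]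
    simp only [Nat.reduceMul] at h2 h4 h6
    rw [h2, h4, h6, sum_const, nsmul_eq_mul]
    linear_combination - (#C : ℝ) / 6 * hcard
  have hself : (zonal 1 x x + zonal 3 x x) ^ 2 = (#C : ℝ) ^ 2 := by
    rw [zonal_three, zonal_two, zonal_one_self]
    congr 1
    linear_combination - hcard / 6
  rw [← add_sum_erase _ _ hx, hself, add_eq_left,
    sum_eq_zero_iff_of_nonneg fun _ _ => sq_nonneg _] at hsum
  have h0 := pow_eq_zero_iff two_ne_zero |>.1 (hsum y (mem_erase.2 ⟨hxy, hy⟩))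
  rw [zonal_three, zonal_two] at h0
  rcases eq_or_ne (zonal 1 x y) 0 with hu | hu
  · exact Or.inl hu
  · refine Or.inr (mul_left_cancel₀ hu ?_)
    linear_combination 6 * h0

theorem length_of_tight {C : Finset (Fin n → ZMod 2)} (h : IsTightKKDesign 3 C) :
    n = 8 ∨ n = 24 := by
  have hn : 6 ≤ n := h.1.2.1
  have hcard := card_tight_three hn
  rw [← h.2] at hcard
  obtain ⟨x, hx⟩ := h.1.2.2.1
  have h2 := IsKKDesign.sum_zonal_eq_zero h.1 (j := 1) le_rfl (by omega) x
  set N : ℕ := #{y ∈ C.erase x | zonal 1 x y ≠ 0} with hN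
  have hsq : ∀ y ∈ C.erase x, zonal 1 x y ^ 2 =
      if zonal 1 x y ≠ 0 then 3 * (n : ℝ) - 8 else 0 := by
    intro y hy
    rw [mem_erase] at hy
    split_ifs with h0
    · exact (zonal_one_of_tight h hx hy.2 hy.1).resolve_left h0
    · rw [not_not.1 h0]; ring
  -- The second moment of the row at x; its diagonal term is n².
  have hsum : (n : ℝ) ^ 2 + N * (3 * n - 8) = n * #C := by
    have h1 : ∑ y ∈ C, (zonal 1 x y ^ 2 - n) = 0 := by
      simp only [Nat.reduceMul, zonal_two, ← sum_div] at h2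
      simpa using h2
    rw [sum_sub_distrib, ← add_sum_erase _ _ hx, sum_congr rfl hsq, ← sum_filter,
      zonal_one_self] at h1
    simp only [sum_const, nsmul_eq_mul, ← hN] at h1
    linarith
  have hcount : 6 * (N : ℝ) * (3 * n - 8) = n ^ 2 * (n - 1) * (n - 2) := by
    linear_combination 6 * hsum + n * hcard
  have hnR : (6 : ℝ) ≤ n := by exact_mod_cast hn
  have hN0 : N ≠ 0 := by
    intro h0
    rw [h0] at hcount
    have : (0 : ℝ) < n ^ 2 * (n - 1) * (n - 2) := by
      have h1 : (0 : ℝ) < n - 1 := by linarith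
      have h2 : (0 : ℝ) < n - 2 := by linarith
      positivity
    rw [Nat.cast_zero] at hcount
    linarith
  obtain ⟨y, hy⟩ := card_pos.1 (Nat.pos_of_ne_zero hN0)
  rw [mem_filter, mem_erase] at hy
  have hm := (zonal_one_of_tight h hx hy.1.2 hy.1.1).resolve_left hy.2
  rw [zonal_one] at hm
  obtain ⟨m, hm⟩ : ∃ m : ℤ, m ^ 2 = 3 * n - 8 :=
    ⟨n - 2 * hammingDist x y, by exact_mod_cast hm⟩
  have hcount' : 6 * (N : ℤ) * (3 * n - 8) = n ^ 2 * (n - 1) * (n - 2) := by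
    exact_mod_cast hcount
  -- Substituting 3n = m² + 8 gives 486 N m² = (m² + 8)²(m² + 5)(m² + 2), whose constant term in m
  -- is 64·5·2 = 640.
  have hdvd : m ^ 2 ∣ 640 := by
    refine ⟨486 * N - (m ^ 6 + 23 * m ^ 4 + 186 * m ^ 2 + 608), ?_⟩
    have hn3 : 3 * (n : ℤ) = m ^ 2 + 8 := by linarith
    rw [← hm] at hcount'
    have e : (486 * N : ℤ) * m ^ 2 = (m ^ 2 + 8) ^ 2 * (m ^ 2 + 5) * (m ^ 2 + 2) := by
      have e1 : (m : ℤ) ^ 2 + 5 = 3 * (n - 1) := by linarith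
      have e2 : (m : ℤ) ^ 2 + 2 = 3 * (n - 2) := by linarith
      rw [e1, e2, ← hn3]
      linear_combination 81 * hcount'
    linear_combination - e
  have hle : m.natAbs ≤ 25 := by
    have := Int.le_of_dvd (by norm_num) hdvd
    rw [← Int.natAbs_sq] at this
    have h' : m.natAbs ^ 2 ≤ 640 := by exact_mod_cast this
    nlinarith
  rw [← Int.natAbs_sq] at hdvd hm
  generalize m.natAbs = a at *
  have hdvd' : a ^ 2 ∣ 640 := by exact_mod_cast hdvd
  interval_cases a <;> omega

end necessary

/-! ### Extremal codes of length 24 and their antipodal halves -/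

section sufficient

/-- A code in `F_2^24` of size `2^12` and minimum distance `8` attains the linear programming
bound given by `(u - 8) u² (u + 8)² (u + 24)`, where `u = 24 - 2d`. -/
theorem extremal_code_moments {D : Finset (Fin 24 → ZMod 2)} (hcard : #D = 4096)
    (hdist : ∀ x ∈ D, ∀ y ∈ D, x ≠ y → 8 ≤ hammingDist x y) :
    (∀ k ∈ Icc 1 6, ∑ x ∈ D, ∑ y ∈ D, zonal k x y = 0) ∧
      ∀ x ∈ D, ∀ y ∈ D, x ≠ y →
        zonal 1 x y = 8 ∨ zonal 1 x y = 0 ∨ zonal 1 x y = -8 ∨ zonal 1 x y = -24 := by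
  set f : ℝ → ℝ := fun u => (u - 8) * u ^ 2 * (u + 8) ^ 2 * (u + 24) with hf
  have hexp : ∀ x y : Fin 24 → ZMod 2, f (zonal 1 x y) =
      720 * zonal 6 x y + 3840 * zonal 5 x y + 10752 * zonal 4 x y + 29952 * zonal 3 x y +
        55152 * zonal 2 x y + 110592 * zonal 1 x y + 110592 := by
    intro x y
    rw [zonal_six, zonal_five, zonal_four, zonal_three, zonal_two]
    simp only [hf]; push_cast; ring
  have hnonpos : ∀ x ∈ D, ∀ y ∈ D.erase x, f (zonal 1 x y) ≤ 0 := by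
    intro x hx y hy
    rw [mem_erase] at hy
    have h8 : (8 : ℝ) ≤ hammingDist x y := by exact_mod_cast hdist x hx y hy.2 hy.1.symm
    have h24 : (hammingDist x y : ℝ) ≤ 24 := by
      have := hammingDist_le_card_fintype (x := x) (y := y)
      rw [Fintype.card_fin] at this
      exact_mod_cast this
    have h1 : zonal 1 x y ≤ 8 := by rw [zonal_one]; push_cast; linarith
    have h2 : 0 ≤ zonal 1 x y + 24 := by rw [zonal_one]; push_cast; linarith
    have h3 : 0 ≤ (8 - zonal 1 x y) * (zonal 1 x y ^ 2 * (zonal 1 x y + 8) ^ 2) *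
        (zonal 1 x y + 24) :=
      mul_nonneg (mul_nonneg (by linarith) (by positivity)) h2
    simp only [hf]; linarith
  have hself : ∀ x : Fin 24 → ZMod 2, f (zonal 1 x x) = 110592 * 4096 := by
    intro x; rw [zonal_one_self]; norm_num [hf]
  have hdiag : ∑ x ∈ D, ∑ y ∈ D, f (zonal 1 x y) =
      110592 * 4096 * 4096 + ∑ x ∈ D, ∑ y ∈ D.erase x, f (zonal 1 x y) := by
    rw [sum_congr rfl fun x hx => (add_sum_erase D (fun y => f (zonal 1 x y)) hx).symm,
      sum_add_distrib]
    simp only [hself, sum_const, hcard]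
    norm_num
  have hfull : ∑ x ∈ D, ∑ y ∈ D, f (zonal 1 x y) =
      720 * ∑ x ∈ D, ∑ y ∈ D, zonal 6 x y + 3840 * ∑ x ∈ D, ∑ y ∈ D, zonal 5 x y +
        10752 * ∑ x ∈ D, ∑ y ∈ D, zonal 4 x y + 29952 * ∑ x ∈ D, ∑ y ∈ D, zonal 3 x y +
        55152 * ∑ x ∈ D, ∑ y ∈ D, zonal 2 x y + 110592 * ∑ x ∈ D, ∑ y ∈ D, zonal 1 x y +
        110592 * 4096 * 4096 := by
    simp only [hexp, sum_add_distrib, ← mul_sum, sum_const, hcard]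
    norm_num
  have hoff : ∑ x ∈ D, ∑ y ∈ D.erase x, f (zonal 1 x y) ≤ 0 :=
    sum_nonpos fun x hx => sum_nonpos (hnonpos x hx)
  have p := sum_sum_zonal_nonneg D
  have p1 := p 1
  have p2 := p 2
  have p3 := p 3
  have p4 := p 4
  have p5 := p 5
  have p6 := p 6
  -- The diagonal contributes exactly as much as the constant term of f. What remains equates a
  -- positive combination of nonnegative moments with a nonpositive off-diagonal sum, so everything
  -- vanishes.
  refine ⟨fun k hk => ?_, fun x hx y hy hxy => ?_⟩
  · have hk' := mem_Icc.1 hk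
    obtain ⟨hk1, hk6⟩ := hk'
    interval_cases k <;> linarith
  · have h0 : ∑ x ∈ D, ∑ y ∈ D.erase x, f (zonal 1 x y) = 0 := by linarith
    rw [sum_eq_zero_iff_of_nonpos fun x hx => sum_nonpos (hnonpos x hx)] at h0
    have h1 := h0 x hx
    rw [sum_eq_zero_iff_of_nonpos (hnonpos x hx)] at h1
    have h2 := h1 y (mem_erase.2 ⟨hxy.symm, hy⟩)
    simp only [hf, mul_eq_zero, pow_eq_zero_iff two_ne_zero] at h2
    rcases h2 with ((h | h) | h) | h
    · left; linarith
    · exact Or.inr (Or.inl h)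
    · right; right; left; linarith
    · right; right; right; linarith

theorem eq_antipode_of_hammingDist_eq {n : ℕ} {x y : Fin n → ZMod 2}
    (h : hammingDist x y = n) : y = antipode x := by
  have h' : #{i | x i ≠ y i} = #(univ : Finset (Fin n)) := by simpa [hammingDist] using h
  rw [card_filter_eq_iff] at h'
  have h2 : ∀ a b : ZMod 2, a ≠ b → b = a + 1 := by decide
  exact funext fun i => h2 _ _ (h' i (mem_univ i))

theorem antipode_mem_of_extremal {D : Finset (Fin 24 → ZMod 2)} (hcard : #D = 4096)
    (hdist : ∀ x ∈ D, ∀ y ∈ D, x ≠ y → 8 ≤ hammingDist x y) {x : Fin 24 → ZMod 2}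
    (hx : x ∈ D) : antipode x ∈ D := by
  obtain ⟨hM, hu⟩ := extremal_code_moments hcard hdist
  by_contra hanti
  have h1 := sum_zonal_eq_zero (hM 1 (by simp)) x
  have h3 := sum_zonal_eq_zero (hM 3 (by simp)) x
  -- The cubic u³ - 64u kills 8, 0 and -8 but not u = 24, so some y must have u = -24.
  have hg : ∑ y ∈ D, (zonal 1 x y ^ 3 - 64 * zonal 1 x y) = 0 := by
    have : ∀ y, zonal 1 x y ^ 3 - 64 * zonal 1 x y = 6 * zonal 3 x y + 6 * zonal 1 x y := by
      intro y; rw [zonal_three, zonal_two]; push_cast; ring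
    simp only [this, sum_add_distrib, ← mul_sum, h1, h3]; norm_num
  rw [← add_sum_erase _ _ hx, zonal_one_self, sum_eq_zero] at hg
  · norm_num at hg
  · intro y hy
    rw [mem_erase] at hy
    rcases hu x hx y hy.2 hy.1.symm with h | h | h | h
    · rw [h]; norm_num
    · rw [h]; norm_num
    · rw [h]; norm_num
    · refine absurd ?_ hanti
      rw [zonal_one] at h
      have hd : (hammingDist x y : ℝ) = (24 : ℕ) := by push_cast at h ⊢; linarith
      rw [← eq_antipode_of_hammingDist_eq (Nat.cast_injective hd)]
      exact hy.2

theorem antipode_antipode {n : ℕ} (x : Fin n → ZMod 2) : antipode (antipode x) = x := by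
  funext i
  simp only [antipode, add_assoc, show (1 : ZMod 2) + 1 = 0 from rfl, add_zero]

theorem antipode_injective {n : ℕ} : Function.Injective (antipode (n := n)) :=
  Function.LeftInverse.injective antipode_antipode

theorem signChar_antipode {n : ℕ} (S : Finset (Fin n)) (x : Fin n → ZMod 2) :
    signChar S (antipode x) = (-1) ^ #S * signChar S x := by
  simp only [signChar, antipode, bitSign_add_one]
  rw [prod_neg]

/-- Characters of even degree do not distinguish antipodes, so even row sums over D are twice those
over a half. -/
theorem zonal_antipode {n : ℕ} {k : ℕ} (hk : Even k) (x y : Fin n → ZMod 2) :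
    zonal k x (antipode y) = zonal k x y := by
  refine sum_congr rfl fun S hS => ?_
  rw [signChar_antipode, (mem_powersetCard.1 hS).2, hk.neg_one_pow, one_mul]

theorem sum_eq_sum_antipodalHalf {n : ℕ} {D C : Finset (Fin n → ZMod 2)}
    (hD : IsAntipodalCode (D : Set (Fin n → ZMod 2)))
    (hC : IsAntipodalHalf (D : Set (Fin n → ZMod 2)) C) {M : Type*} [AddCommMonoid M]
    (f : (Fin n → ZMod 2) → M) :
    ∑ y ∈ D, f y = ∑ y ∈ C, (f y + f (antipode y)) := by
  have hdisj : Disjoint C (C.image antipode) := by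
    rw [disjoint_left]
    intro x hx hx'
    obtain ⟨y, hy, rfl⟩ := mem_image.1 hx'
    rcases hC.2 y (hC.1 y hy) with h | h
    · exact h.2 hx
    · exact h.2 hy
  have hunion : D = C ∪ C.image antipode := by
    ext x
    rw [mem_union, mem_image]
    constructor
    · intro hx
      rcases hC.2 x hx with h | h
      · exact Or.inl h.1
      · exact Or.inr ⟨_, h.1, antipode_antipode x⟩
    · rintro (h | ⟨y, hy, rfl⟩)
      · exact hC.1 x h
      · exact hD _ (hC.1 y hy)
  rw [hunion, sum_union hdisj, sum_image antipode_injective.injOn, sum_add_distrib]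

theorem exists_antipodalHalf {n : ℕ} (i : Fin n) {D : Finset (Fin n → ZMod 2)}
    (hD : IsAntipodalCode (D : Set (Fin n → ZMod 2))) :
    ∃ C, IsAntipodalHalf (D : Set (Fin n → ZMod 2)) C := by
  -- Antipodes differ in coordinate i, so fixing that bit selects one of each pair.
  refine ⟨{x ∈ D | x i = 0}, fun x hx => (mem_filter.1 hx).1, fun x hx => ?_⟩
  have h : x i + 1 = 0 ↔ ¬ x i = 0 := by generalize x i = a; revert a; decide
  have hx' : x ∈ D := hx
  have hax : antipode x ∈ D := hD x hx
  have e : antipode x i = x i + 1 := rfl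
  simp only [mem_filter, hx', hax, true_and, e, h]
  by_cases h0 : x i = 0
  · exact Or.inl ⟨h0, not_not.2 h0⟩
  · exact Or.inr ⟨h0, h0⟩

theorem isTightKKDesign_antipodalHalf {D C : Finset (Fin 24 → ZMod 2)} (hcard : #D = 4096)
    (hdist : ∀ x ∈ D, ∀ y ∈ D, x ≠ y → 8 ≤ hammingDist x y)
    (hC : IsAntipodalHalf (D : Set (Fin 24 → ZMod 2)) C) :
    IsTightKKDesign 3 C ∧ #C = 2048 := by
  have hanti : IsAntipodalCode (D : Set (Fin 24 → ZMod 2)) := fun x hx =>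
    antipode_mem_of_extremal hcard hdist hx
  have hCcard : #C = 2048 := by
    have h := sum_eq_sum_antipodalHalf hanti hC fun _ => 1
    simp only [sum_const, smul_eq_mul, mul_one, hcard] at h
    omega
  refine ⟨⟨⟨by norm_num, by norm_num, card_pos.1 (by omega), ?_, ?_⟩, ?_⟩, hCcard⟩
  · rintro _ ⟨j, ⟨h1, h2⟩, rfl⟩
    exact ⟨by omega, by omega⟩
  · rintro _ ⟨j, ⟨h1, h2⟩, rfl⟩
    rw [codeMoment_eq_zero_iff (by norm_num) (by omega)]
    refine sum_eq_zero fun x _ => ?_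
    have h := sum_zonal_eq_zero
      ((extremal_code_moments hcard hdist).1 (2 * j) (mem_Icc.2 ⟨by omega, by omega⟩)) x
    rw [sum_eq_sum_antipodalHalf hanti hC] at h
    simp only [zonal_antipode (even_two_mul j), sum_add_distrib] at h
    linarith
  · rw [hCcard]; decide

end sufficient

open Classical in
theorem IsBinaryLinearCode.toFinset_extremal {D : Submodule (ZMod 2) (Fin 24 → ZMod 2)}
    (hD : IsBinaryLinearCode 24 12 8 D) :
    ∃ E : Finset (Fin 24 → ZMod 2), (E : Set (Fin 24 → ZMod 2)) = D ∧ #E = 4096 ∧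
      ∀ x ∈ E, ∀ y ∈ E, x ≠ y → 8 ≤ hammingDist x y := by
  refine ⟨univ.filter (· ∈ D), by ext; simp, ?_, fun x hx y hy hxy => ?_⟩
  · have h := Module.card_eq_pow_finrank (K := ZMod 2) (V := D)
    rw [hD.1, ZMod.card] at h
    rw [← Fintype.card_subtype]
    exact h
  · exact hD.2.2 ⟨x, by simpa using hx, y, by simpa using hy, hxy, rfl⟩

theorem theorem5p4 :
    (∀ (n : ℕ) (C : Finset (Fin n → ZMod 2)), IsTightKKDesign 3 C →
      ∃ m : ℕ, 4 ≤ m ∧ 3 * n = m ^ 2 + 8 ∧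
        ((n ≡ 8 [MOD 16] ∧ 4 ∣ m ∧ ¬ 3 ∣ m) ∨
          (n ≡ 107 [MOD 128] ∧ m ≡ 43 [MOD 64]))) ∧
    IsBinaryLinearCode 24 12 8 extendedGolayCode ∧
    (∀ D : Submodule (ZMod 2) (Fin 24 → ZMod 2), IsBinaryLinearCode 24 12 8 D →
      IsAntipodalCode (D : Set (Fin 24 → ZMod 2)) ∧
      (∃ C : Finset (Fin 24 → ZMod 2), IsAntipodalHalf (D : Set (Fin 24 → ZMod 2)) C) ∧
      ∀ C : Finset (Fin 24 → ZMod 2), IsAntipodalHalf (D : Set (Fin 24 → ZMod 2)) C →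
        IsTightKKDesign 3 C ∧ C.card = 2048) := by
  refine ⟨fun n C hC => ?_, isBinaryLinearCode_extendedGolayCode, fun D hD => ?_⟩
  · rcases length_of_tight hC with rfl | rfl
    · exact ⟨4, by decide⟩
    · exact ⟨8, by decide⟩
  · obtain ⟨E, hE, hcard, hdist⟩ := hD.toFinset_extremal
    rw [← hE]
    have hanti : IsAntipodalCode (E : Set (Fin 24 → ZMod 2)) := fun x hx =>
      antipode_mem_of_extremal hcard hdist hx
    exact ⟨hanti, exists_antipodalHalf 0 hanti, fun C hC =>
      isTightKKDesign_antipodalHalf hcard hdist hC⟩
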